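/- Theorem 3. There is a function $f:\mathbb R\to\mathbb R$ with $f(\Delta)\to 0$ as $\Delta\to\infty$ such that the following holds. Let $\Delta>1$ be a real number and let $G$ be a finite simple graph on $n$ vertices in which every vertex has degree at most $\Delta$ and every pair of distinct vertices has at most $2^{-7}\Delta(\log\Delta)^{-7}$ common neighbours, where $\log$ is the natural logarithm. Then $G$ has an independent set of size at least $$(1-f(\Delta))\,\frac{n\log\Delta}{\Delta}.$$ In other words, $\alpha(G)\ge(1-o(1))\,n\log\Delta/\Delta$, where $\alpha(G)$ is the largest size of an independent set of $G$ and the $o(1)$ term depends only on $\Delta$ and tends to $0$ as $\Delta\to\infty$. -/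

import Mathlib

/-- The maximum codegree of a finite graph: the largest number of common neighbours of two distinct
vertices (and `0` if there are fewer than two vertices). -/
def SimpleGraph.maxCodegree {V : Type*} (G : SimpleGraph V) [Fintype V] [DecidableEq V]
    [DecidableRel G.Adj] : ℕ :=
  (Finset.univ : Finset V).offDiag.sup
    fun p => (G.neighborFinset p.1 ∩ G.neighborFinset p.2).card

/-! The proof is a Rödl nibble. Each round selects vertices of the current set at random, keeps the
selected ones with no selected neighbour, and passes on the vertices with nothing selected in their
closed neighbourhood. If survival has probability `exp (-ε)`, then after `i` rounds about `n * exp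
(-ε * i)` vertices of degree at most about `Δ * exp (-ε * i)` remain, so every round gains about `ε
* n / Δ`. About `log Δ / ε` rounds are possible before degrees fall to `Δ ^ ε`, for a total near `n
* log Δ / Δ`.

Small codegrees make survival nearly independent: the sets whose selection kills two distinct
vertices barely overlap (`sum_card_le_card_biUnion_add`). Hence the `k`-th binomial moments of
degrees and codegrees shrink at almost the independent rate, and by Markov with `k` near `log Δ` few
vertices exceed the thresholds and are discarded.

No concentration is needed. A single functional `b * #W - c * degreeMoment - d * codegreeMoment` is
bounded in expectation in each round (`exists_nibble`), and backward induction on the rounds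
(`exists_isIndepSet_of_weights`) turns this into a bound on the independent set. The rest is the
choice of weights. -/

set_option linter.unusedSectionVars false

/-! ### Random subsets, near-independent survival and binomial moments. -/

section Nibble

open Finset

variable {Ω : Type*} [Fintype Ω] [DecidableEq Ω]

/-- The probability of `A` when every point is selected independently with probability `p`. -/
noncomputable def bernoulliWeight (p : ℝ) (A : Finset Ω) : ℝ :=
  p ^ #A * (1 - p) ^ #Aᶜ

lemma bernoulliWeight_nonneg {p : ℝ} (h0 : 0 ≤ p) (h1 : p ≤ 1) (A : Finset Ω) :
    0 ≤ bernoulliWeight p A :=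
  mul_nonneg (pow_nonneg h0 _) (pow_nonneg (sub_nonneg.2 h1) _)

lemma sum_bernoulliWeight_filter (p : ℝ) {S F : Finset Ω} (h : Disjoint S F) :
    ∑ A with S ⊆ A ∧ Disjoint A F, bernoulliWeight p A = p ^ #S * (1 - p) ^ #F := by
  -- Expanding the product over subsets `A` gives the weight of `A`, with a zero factor exactly when
  -- `A` misses a point of `S` or meets `F`.
  have key := Finset.prod_add (fun i => if i ∈ F then 0 else p)
    (fun i => if i ∈ S then 0 else 1 - p) (univ : Finset Ω)
  have hl : ∏ i : Ω, ((if i ∈ F then 0 else p) + (if i ∈ S then 0 else 1 - p))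
      = p ^ #S * (1 - p) ^ #F := by
    have : ∀ i : Ω, ((if i ∈ F then 0 else p) + (if i ∈ S then 0 else 1 - p))
        = (if i ∈ S then p else 1) * (if i ∈ F then 1 - p else 1) := by
      intro i
      by_cases hF : i ∈ F
      · have hS : i ∉ S := fun hS => Finset.disjoint_left.1 h hS hF
        simp [hF, hS]
      · by_cases hS : i ∈ S <;> simp [hF, hS]
    rw [Finset.prod_congr rfl (fun i _ => this i), Finset.prod_mul_distrib]
    simp [Finset.prod_ite_mem]
  rw [← hl, key, Finset.sum_filter, Finset.powerset_univ]
  refine Finset.sum_congr rfl fun A _ => ?_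
  split_ifs with hA
  · rw [bernoulliWeight, ← Finset.prod_const, ← Finset.prod_const, Finset.compl_eq_univ_sdiff]
    congr 1
    · exact Finset.prod_congr rfl fun i hi => by simp [Finset.disjoint_left.1 hA.2 hi]
    · refine Finset.prod_congr rfl fun i hi => ?_
      have : i ∉ S := fun hS => (Finset.mem_sdiff.1 hi).2 (hA.1 hS)
      simp [this]
  · symm
    rw [not_and_or, Finset.not_subset, Finset.not_disjoint_iff] at hA
    rcases hA with ⟨i, hiS, hiA⟩ | ⟨i, hiA, hiF⟩
    · rw [Finset.prod_eq_zero (s := univ \ A) (i := i) (by simp [hiA]) (by simp [hiS]), mul_zero]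
    · rw [Finset.prod_eq_zero (s := A) (i := i) hiA (by simp [hiF]), zero_mul]

lemma sum_bernoulliWeight (p : ℝ) : ∑ A : Finset Ω, bernoulliWeight p A = 1 := by
  simpa using sum_bernoulliWeight_filter p (disjoint_empty_left (∅ : Finset Ω))

lemma sum_bernoulliWeight_disjoint (p : ℝ) (F : Finset Ω) :
    ∑ A with Disjoint A F, bernoulliWeight p A = (1 - p) ^ #F := by
  simpa using sum_bernoulliWeight_filter p (disjoint_empty_left F)

lemma exists_le_of_le_expectation {p X : ℝ} (h0 : 0 ≤ p) (h1 : p ≤ 1) (f : Finset Ω → ℝ)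
    (h : X ≤ ∑ A, bernoulliWeight p A * f A) : ∃ A, X ≤ f A := by
  by_contra! hf
  have h2 : ∑ A, bernoulliWeight p A * (f A - X) = ∑ A, bernoulliWeight p A * f A - X := by
    simp_rw [mul_sub, Finset.sum_sub_distrib, ← Finset.sum_mul, sum_bernoulliWeight, one_mul]
  have hnp : ∀ A ∈ (univ : Finset (Finset Ω)), bernoulliWeight p A * (f A - X) ≤ 0 := fun A _ =>
    mul_nonpos_of_nonneg_of_nonpos (bernoulliWeight_nonneg h0 h1 A) (by linarith [hf A])
  have h3 : ∑ A, bernoulliWeight p A * (f A - X) = 0 :=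
    le_antisymm (Finset.sum_nonpos hnp) (by linarith)
  have h4 := (Finset.sum_eq_zero_iff_of_nonpos hnp).1 h3
  have h5 : ∀ A : Finset Ω, bernoulliWeight p A = 0 := fun A => by
    rcases mul_eq_zero.1 (h4 A (mem_univ A)) with h | h
    · exact h
    · linarith [hf A]
  have := sum_bernoulliWeight (Ω := Ω) p
  simp [h5] at this

/-- A crude Bonferroni inequality: each new set meets the union of the earlier ones in at most `h`
points per earlier set. -/
lemma sum_card_le_card_biUnion_add {ι : Type*} [DecidableEq ι] (S : Finset ι) (F : ι → Finset Ω)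
    (h : ℕ) (hF : ∀ i ∈ S, ∀ j ∈ S, i ≠ j → #(F i ∩ F j) ≤ h) :
    ∑ i ∈ S, #(F i) ≤ #(S.biUnion F) + #S ^ 2 * h := by
  induction S using Finset.induction_on with
  | empty => simp
  | insert a S ha ih =>
    have ih' := ih fun i hi j hj => hF i (mem_insert_of_mem hi) j (mem_insert_of_mem hj)
    rw [sum_insert ha, biUnion_insert, card_insert_of_notMem ha]
    have h1 := card_union_add_card_inter (F a) (S.biUnion F)
    have h2 : #(F a ∩ S.biUnion F) ≤ #S * h := by
      rw [Finset.inter_biUnion]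
      refine card_biUnion_le_card_mul _ _ _ fun j hj => ?_
      exact hF a (mem_insert_self _ _) j (mem_insert_of_mem hj) fun e => ha (e ▸ hj)
    nlinarith

variable {V : Type*} [Fintype V] [DecidableEq V]

/-- The points of `W` whose set of killers is not met by `A`. -/
def survivors (F : V → Finset Ω) (W : Finset V) (A : Finset Ω) : Finset V :=
  W.filter fun v => Disjoint A (F v)

lemma subset_survivors_iff {F : V → Finset Ω} {W S : Finset V} (hS : S ⊆ W) (A : Finset Ω) :
    S ⊆ survivors F W A ↔ Disjoint A (S.biUnion F) := by
  rw [Finset.disjoint_biUnion_right]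
  refine ⟨fun h v hv => (mem_filter.1 (h hv)).2, fun h v hv => mem_filter.2 ⟨hS hv, h v hv⟩⟩

/-- All of `S` survives iff the union of its killer sets is unselected. The numerator is the value
under independence; the denominator pays for shared killers. -/
lemma sum_bernoulliWeight_subset_survivors {p : ℝ} (h0 : 0 ≤ p) (h1 : p < 1)
    {F : V → Finset Ω} {W S : Finset V} (hS : S ⊆ W) {M h : ℕ} (hM : ∀ v ∈ W, #(F v) = M)
    (hF : ∀ u ∈ W, ∀ v ∈ W, u ≠ v → #(F u ∩ F v) ≤ h) :
    ∑ A with S ⊆ survivors F W A, bernoulliWeight p A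
      ≤ (1 - p) ^ (M * #S) / (1 - p) ^ (#S ^ 2 * h) := by
  simp_rw [subset_survivors_iff hS]
  rw [sum_bernoulliWeight_disjoint, le_div_iff₀ (pow_pos (by linarith) _), ← pow_add]
  refine pow_le_pow_of_le_one (by linarith) (by linarith) ?_
  have := sum_card_le_card_biUnion_add S F h fun i hi j hj => hF i (hS hi) j (hS hj)
  rwa [sum_congr rfl fun i hi => hM i (hS hi), sum_const, smul_eq_mul, mul_comm] at this

lemma sum_bernoulliWeight_card_survivors (p : ℝ) {F : V → Finset Ω} {W : Finset V} {M : ℕ}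
    (hM : ∀ v ∈ W, #(F v) = M) :
    ∑ A, bernoulliWeight p A * (#(survivors F W A) : ℝ) = (1 - p) ^ M * #W := by
  simp_rw [survivors, card_filter, Nat.cast_sum, mul_sum]
  rw [sum_comm, sum_congr rfl (g := fun _ => (1 - p) ^ M)]
  · simp [mul_comm]
  · intro v hv
    rw [← hM v hv, ← sum_bernoulliWeight_disjoint, sum_filter]
    exact sum_congr rfl fun A _ => by split_ifs <;> simp

/-- The number of pairs `(j, S)` with `S` a `k`-subset of `N j` and `C j ∪ S ⊆ W`. -/
def binomialMoment {ι : Type*} (J : Finset ι) (C N : ι → Finset V) (k : ℕ) (W : Finset V) : ℕ :=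
  ∑ j ∈ J, #{S ∈ (N j).powersetCard k | C j ∪ S ⊆ W}

section binomialMoment

variable {ι : Type*} {J : Finset ι} {C N : ι → Finset V} {k : ℕ}

lemma binomialMoment_mono {W W' : Finset V} (h : W ⊆ W') :
    binomialMoment J C N k W ≤ binomialMoment J C N k W' :=
  sum_le_sum fun _ _ => card_le_card fun S hS => by
    rw [mem_filter] at hS ⊢
    exact ⟨hS.1, hS.2.trans h⟩

lemma binomialMoment_univ : binomialMoment J C N k univ = ∑ j ∈ J, (#(N j)).choose k := by
  simp [binomialMoment]

/-- Markov's inequality for binomial moments: each such `j` alone contributes at least `(D +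
1).choose k` pairs. -/
lemma card_large_mul_choose_le (W : Finset V) (D : ℕ) :
    #{j ∈ J | C j ⊆ W ∧ D < #(N j ∩ W)} * (D + 1).choose k ≤ binomialMoment J C N k W := by
  rw [← smul_eq_mul, ← sum_const]
  refine (sum_le_sum fun j hj => ?_).trans
    (sum_le_sum_of_subset_of_nonneg (filter_subset _ _) fun _ _ _ => Nat.zero_le _)
  obtain ⟨-, hC, hD⟩ := mem_filter.1 hj
  refine (Nat.choose_le_choose k hD).trans ?_
  rw [← card_powersetCard]
  refine card_le_card fun S hS => ?_
  rw [mem_powersetCard] at hS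
  rw [mem_filter, mem_powersetCard]
  exact ⟨⟨hS.1.trans inter_subset_left, hS.2⟩, union_subset hC (hS.1.trans inter_subset_right)⟩

lemma sum_bernoulliWeight_binomialMoment_le {p : ℝ} (h0 : 0 ≤ p) (h1 : p < 1)
    {F : V → Finset Ω} {W : Finset V} {M h c : ℕ} (hM : ∀ v ∈ W, #(F v) = M)
    (hF : ∀ u ∈ W, ∀ v ∈ W, u ≠ v → #(F u ∩ F v) ≤ h)
    (hc : ∀ j ∈ J, #(C j) = c) (hCN : ∀ j ∈ J, Disjoint (C j) (N j)) :
    ∑ A, bernoulliWeight p A * (binomialMoment J C N k (survivors F W A) : ℝ)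
      ≤ (1 - p) ^ (M * (c + k)) / (1 - p) ^ ((c + k) ^ 2 * h) * binomialMoment J C N k W := by
  simp_rw [binomialMoment, Nat.cast_sum, mul_sum]
  rw [sum_comm]
  refine sum_le_sum fun j hj => ?_
  simp_rw [card_filter, Nat.cast_sum, mul_sum]
  rw [sum_comm]
  refine sum_le_sum fun S hS => ?_
  rw [mem_powersetCard] at hS
  by_cases hW : C j ∪ S ⊆ W
  · have hcard : #(C j ∪ S) = c + k := by
      rw [card_union_of_disjoint ((hCN j hj).mono_right hS.1), hc j hj, hS.2]
    have := sum_bernoulliWeight_subset_survivors h0 h1 hW hM hF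
    rw [hcard, sum_filter] at this
    simpa [hW] using this
  · have : ∀ A, ¬ C j ∪ S ⊆ survivors F W A := fun A h => hW (h.trans (filter_subset _ _))
    simp [hW, this]

end binomialMoment

end Nibble

/-! ### One nibble round on a graph, and its iteration. -/

section NibbleGraph

open Finset

variable {V : Type*} [Fintype V] [DecidableEq V] (G : SimpleGraph V) [DecidableRel G.Adj]

/-- The `k`-th binomial moment of the degrees in the subgraph induced on `W`. -/
def degreeMoment (k : ℕ) (W : Finset V) : ℕ :=
  binomialMoment univ (fun v => {v}) (fun v => G.neighborFinset v) k W

/-- The `k`-th binomial moment of the codegrees in the subgraph induced on `W`. -/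
def codegreeMoment (k : ℕ) (W : Finset V) : ℕ :=
  binomialMoment univ.offDiag (fun q : V × V => {q.1, q.2})
    (fun q => G.neighborFinset q.1 ∩ G.neighborFinset q.2) k W

/-- The closed neighbourhood of `v` in `W`, padded with dummy points to size `M`. -/
def killers (W : Finset V) (M : ℕ) (v : V) : Finset (V ⊕ V × Fin M) :=
  (insert v (G.neighborFinset v ∩ W)).disjSum
    ({v} ×ˢ univ.filter fun i : Fin M => (i : ℕ) < M - #(insert v (G.neighborFinset v ∩ W)))

variable {G} {W : Finset V} {D H : ℕ}

/-- Padding equalises the survival probabilities, so one factor governs the whole round. -/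
lemma card_killers {v : V} (hD : #(G.neighborFinset v ∩ W) ≤ D) :
    #(killers G W (D + 1) v) = D + 1 := by
  have h : #(insert v (G.neighborFinset v ∩ W)) ≤ D + 1 := (card_insert_le _ _).trans (by omega)
  rw [killers, card_disjSum, card_product, card_singleton, one_mul, Fin.card_filter_val_lt]
  omega

/-- Dummies are labelled by their vertex, hence never shared; besides common neighbours only `u` and
`v` themselves can be, whence the `+ 2`. -/
lemma card_killers_inter {u v : V} (huv : u ≠ v) (M : ℕ)
    (hH : #(G.neighborFinset u ∩ G.neighborFinset v ∩ W) ≤ H) :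
    #(killers G W M u ∩ killers G W M v) ≤ H + 2 := by
  have hsub : killers G W M u ∩ killers G W M v ⊆
      (insert u (insert v (G.neighborFinset u ∩ G.neighborFinset v ∩ W))).map
        Function.Embedding.inl := by
    intro x hx
    rw [mem_inter] at hx
    rcases x with x | ⟨x, i⟩
    · simp only [killers, inl_mem_disjSum, mem_insert, mem_inter] at hx
      simp only [mem_map, Function.Embedding.inl_apply, Sum.inl.injEq, exists_eq_right, mem_insert,
        mem_inter]
      tauto
    · simp only [killers, inr_mem_disjSum, mem_product, mem_singleton] at hx
      exact absurd (hx.1.1.symm.trans hx.2.1) huv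
  refine (card_le_card hsub).trans ?_
  rw [card_map]
  have h1 := card_insert_le u (insert v (G.neighborFinset u ∩ G.neighborFinset v ∩ W))
  have h2 := card_insert_le v (G.neighborFinset u ∩ G.neighborFinset v ∩ W)
  omega

variable (G) in
/-- The selected vertices of `W` without selected neighbours in `W`. -/
def isolatedSelected (W : Finset V) {M : ℕ} (A : Finset (V ⊕ V × Fin M)) : Finset V :=
  W.filter fun v => Sum.inl v ∈ A ∧ ∀ w ∈ G.neighborFinset v ∩ W, Sum.inl w ∉ A

lemma le_sum_bernoulliWeight_card_isolatedSelected {p : ℝ} (h0 : 0 ≤ p) (h1 : p ≤ 1) (M : ℕ)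
    (hD : ∀ v ∈ W, #(G.neighborFinset v ∩ W) ≤ D) :
    (1 - p) ^ (D + 1) * p * #W
      ≤ ∑ A : Finset (V ⊕ V × Fin M), bernoulliWeight p A * (#(isolatedSelected G W A) : ℝ) := by
  simp_rw [isolatedSelected, card_filter, Nat.cast_sum, mul_sum]
  rw [sum_comm, mul_comm, ← nsmul_eq_mul]
  refine card_nsmul_le_sum _ _ _ fun v hv => ?_
  set F : Finset (V ⊕ V × Fin M) := (G.neighborFinset v ∩ W).map Function.Embedding.inl with hF
  have hdisj : Disjoint {Sum.inl v} F := by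
    simp [hF]
  have hs := sum_bernoulliWeight_filter p hdisj
  have hle : (1 - p) ^ (D + 1) * p ≤ p ^ #({Sum.inl v} : Finset (V ⊕ V × Fin M)) * (1 - p) ^ #F := by
    rw [card_singleton, pow_one, mul_comm]
    refine mul_le_mul_of_nonneg_left ?_ h0
    refine pow_le_pow_of_le_one (by linarith) (by linarith) ?_
    -- Exponent `D` would do; `D + 1` matches the survival probability, so that both terms share a
    -- factor in `exists_nibble`.
    rw [hF, card_map]
    exact (hD v hv).trans (Nat.le_succ _)
  refine hle.trans (le_of_eq ?_)
  rw [← hs, sum_filter]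
  refine sum_congr rfl fun A _ => ?_
  have hiff : ({Sum.inl v} ⊆ A ∧ Disjoint A F) ↔
      (Sum.inl v ∈ A ∧ ∀ w ∈ G.neighborFinset v ∩ W, Sum.inl w ∉ A) := by
    rw [singleton_subset_iff, hF, disjoint_right]
    refine and_congr_right fun _ => ⟨fun h w hw => h (mem_map_of_mem _ hw), fun h a ha => ?_⟩
    obtain ⟨w, hw, rfl⟩ := mem_map.1 ha
    exact h w hw
  simp only [hiff]
  split_ifs <;> simp

/-- One step of the nibble: an independent set `I` and a set `W'` of remaining vertices, none of
them in or adjacent to `I`, for which a linear combination of the size and the moments is at least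
its mean. -/
lemma exists_nibble {p : ℝ} (h0 : 0 ≤ p) (h1 : p < 1) (k : ℕ)
    (hD : ∀ v ∈ W, #(G.neighborFinset v ∩ W) ≤ D)
    (hH : ∀ u ∈ W, ∀ v ∈ W, u ≠ v → #(G.neighborFinset u ∩ G.neighborFinset v ∩ W) ≤ H)
    {b c d : ℝ} (hc : 0 ≤ c) (hd : 0 ≤ d) :
    ∃ I W' : Finset V, I ⊆ W ∧ W' ⊆ W ∧ G.IsIndepSet (I : Set V) ∧
      (∀ a ∈ I, ∀ w ∈ W', a ≠ w ∧ ¬ G.Adj a w) ∧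
      (1 - p) ^ (D + 1) * (p + b) * #W
        - c * ((1 - p) ^ ((D + 1) * (1 + k)) / (1 - p) ^ ((1 + k) ^ 2 * (H + 2))
            * degreeMoment G k W)
        - d * ((1 - p) ^ ((D + 1) * (2 + k)) / (1 - p) ^ ((2 + k) ^ 2 * (H + 2))
            * codegreeMoment G k W)
      ≤ #I + b * #W' - c * degreeMoment G k W' - d * codegreeMoment G k W' := by
  set F := killers G W (D + 1) with hFdef
  have hM : ∀ v ∈ W, #(F v) = D + 1 := fun v hv => card_killers (hD v hv)
  have hF : ∀ u ∈ W, ∀ v ∈ W, u ≠ v → #(F u ∩ F v) ≤ H + 2 := fun u hu v hv huv =>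
    card_killers_inter huv _ (hH u hu v hv huv)
  have e1 := le_sum_bernoulliWeight_card_isolatedSelected h0 h1.le (D + 1) hD
  have e2 := sum_bernoulliWeight_card_survivors p hM
  have e3 : _ ≤ _ * ((degreeMoment G k W : ℕ) : ℝ) :=
    sum_bernoulliWeight_binomialMoment_le h0 h1 hM hF (J := univ)
    (C := fun v => {v}) (N := fun v => G.neighborFinset v) (k := k) (c := 1) (by simp) (by simp)
  have e4 : _ ≤ _ * ((codegreeMoment G k W : ℕ) : ℝ) :=
    sum_bernoulliWeight_binomialMoment_le h0 h1 hM hF (J := univ.offDiag)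
    (C := fun q : V × V => {q.1, q.2})
    (N := fun q => G.neighborFinset q.1 ∩ G.neighborFinset q.2) (k := k) (c := 2)
    (fun q hq => card_pair (mem_offDiag.1 hq).2.2) (fun q _ => by simp)
  obtain ⟨A, hA⟩ := exists_le_of_le_expectation h0 h1.le
    (fun A => (#(isolatedSelected G W A) : ℝ) + b * #(survivors F W A)
      - c * degreeMoment G k (survivors F W A) - d * codegreeMoment G k (survivors F W A))
    (X := (1 - p) ^ (D + 1) * (p + b) * #W
        - c * ((1 - p) ^ ((D + 1) * (1 + k)) / (1 - p) ^ ((1 + k) ^ 2 * (H + 2))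
            * degreeMoment G k W)
        - d * ((1 - p) ^ ((D + 1) * (2 + k)) / (1 - p) ^ ((2 + k) ^ 2 * (H + 2))
            * codegreeMoment G k W)) (by
      have hsum : ∀ A : Finset (V ⊕ V × Fin (D + 1)), bernoulliWeight p A *
          ((#(isolatedSelected G W A) : ℝ) + b * #(survivors F W A)
            - c * degreeMoment G k (survivors F W A) - d * codegreeMoment G k (survivors F W A))
          = bernoulliWeight p A * (#(isolatedSelected G W A) : ℝ)
            + b * (bernoulliWeight p A * (#(survivors F W A) : ℝ))
            - c * (bernoulliWeight p A * (degreeMoment G k (survivors F W A) : ℝ))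
            - d * (bernoulliWeight p A * (codegreeMoment G k (survivors F W A) : ℝ)) :=
        fun A => by ring
      simp_rw [hsum, sum_sub_distrib, sum_add_distrib, ← mul_sum]
      rw [e2]
      have e3' := mul_le_mul_of_nonneg_left e3 hc
      have e4' := mul_le_mul_of_nonneg_left e4 hd
      have : (1 - p) ^ (D + 1) * (p + b) * (#W : ℝ)
        = (1 - p) ^ (D + 1) * p * #W + b * ((1 - p) ^ (D + 1) * #W) := by ring
      rw [this]
      exact sub_le_sub (sub_le_sub (add_le_add e1 le_rfl) e3') e4')
  refine ⟨isolatedSelected G W A, survivors F W A, filter_subset _ _, filter_subset _ _, ?_, ?_, hA⟩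
  · intro u hu v hv _ hadj
    have hu' := mem_filter.1 (mem_coe.1 hu)
    have hv' := mem_filter.1 (mem_coe.1 hv)
    exact hu'.2.2 v (by simp [hadj, hv'.1]) hv'.2.1
  · intro a ha w hw
    have ha' := mem_filter.1 ha
    have hw' := mem_filter.1 hw
    have hnot : Sum.inl a ∉ F w := disjoint_left.1 hw'.2 ha'.2.1
    rw [hFdef, killers, inl_mem_disjSum, mem_insert, mem_inter, G.mem_neighborFinset] at hnot
    push Not at hnot
    exact ⟨hnot.1, fun hadj => hnot.2 hadj.symm ha'.1⟩

variable (G) in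
lemma exists_bounded_subset (W : Finset V) {k : ℕ} (hkD : k ≤ D + 1) (hkH : k ≤ H + 1) :
    ∃ W' ⊆ W, (∀ v ∈ W', #(G.neighborFinset v ∩ W') ≤ D) ∧
      (∀ u ∈ W', ∀ v ∈ W', u ≠ v → #(G.neighborFinset u ∩ G.neighborFinset v ∩ W') ≤ H) ∧
      (#W : ℝ) - degreeMoment G k W / (D + 1).choose k
        - codegreeMoment G k W / (H + 1).choose k ≤ #W' := by
  set B₁ := {v ∈ (univ : Finset V) | {v} ⊆ W ∧ D < #(G.neighborFinset v ∩ W)} with hB₁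
  set P := {q ∈ (univ : Finset V).offDiag | {q.1, q.2} ⊆ W ∧
    H < #((G.neighborFinset q.1 ∩ G.neighborFinset q.2) ∩ W)} with hP
  have h1 : #B₁ * (D + 1).choose k ≤ degreeMoment G k W := card_large_mul_choose_le W D
  have h2 : #P * (H + 1).choose k ≤ codegreeMoment G k W := card_large_mul_choose_le W H
  -- Removing one vertex of each bad pair suffices, and deletion never raises the other degrees or
  -- codegrees.
  have hsub : W \ (B₁ ∪ P.image Prod.fst) ⊆ W := sdiff_subset
  refine ⟨W \ (B₁ ∪ P.image Prod.fst), hsub, ?_, ?_, ?_⟩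
  · intro v hv
    refine (card_le_card (inter_subset_inter_left hsub)).trans ?_
    by_contra! h
    rw [mem_sdiff, mem_union] at hv
    exact hv.2 (Or.inl (by simp [hB₁, hv.1, h]))
  · intro u hu v hv huv
    refine (card_le_card (inter_subset_inter_left hsub)).trans ?_
    by_contra! h
    have hvW := hsub hv
    rw [mem_sdiff, mem_union] at hu
    refine hu.2 (Or.inr (mem_image.2 ⟨(u, v), mem_filter.2 ⟨by simp [huv], ?_, h⟩, rfl⟩))
    simp [insert_subset_iff, hu.1, hvW]
  · have hC1 : (0 : ℝ) < (D + 1).choose k := by exact_mod_cast Nat.choose_pos hkD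
    have hC2 : (0 : ℝ) < (H + 1).choose k := by exact_mod_cast Nat.choose_pos hkH
    have h1' : (#B₁ : ℝ) ≤ degreeMoment G k W / (D + 1).choose k := by
      rw [le_div_iff₀ hC1]; exact_mod_cast h1
    have h2' : (#P : ℝ) ≤ codegreeMoment G k W / (H + 1).choose k := by
      rw [le_div_iff₀ hC2]; exact_mod_cast h2
    have h3 : #W ≤ #(W \ (B₁ ∪ P.image Prod.fst)) + (#B₁ + #P) := by
      have := le_card_sdiff (B₁ ∪ P.image Prod.fst) W
      have := card_union_le B₁ (P.image Prod.fst)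
      have := card_image_le (s := P) (f := Prod.fst)
      omega
    have h3' : (#W : ℝ) ≤ #(W \ (B₁ ∪ P.image Prod.fst)) + (#B₁ + #P) := by exact_mod_cast h3
    linarith

variable (G) in
/-- The iterated nibble. At step `i` vertices of degree above `D i` or codegree above `H i` are
discarded and every vertex survives with probability `exp (-x i * (D i + 1))`. -/
theorem exists_isIndepSet_of_weights (k T : ℕ) (D H : ℕ → ℕ) (x b c d : ℕ → ℝ)
    (hx : ∀ i < T, 0 ≤ x i) (hkD : ∀ i < T, k ≤ D i + 1) (hkH : ∀ i < T, k ≤ H i + 1)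
    (hb : ∀ i, 0 ≤ b i) (hc : ∀ i, 0 ≤ c i) (hd : ∀ i, 0 ≤ d i) (hbT : b T = 0)
    (hbi : ∀ i < T, b i ≤ Real.exp (-x i * (D i + 1)) * (1 - Real.exp (-x i) + b (i + 1)))
    (hci : ∀ i < T, c (i + 1) * (Real.exp (-x i * (D i + 1) * (1 + k)) *
      Real.exp (x i * (1 + k) ^ 2 * (H i + 2))) + b i / (D i + 1).choose k ≤ c i)
    (hdi : ∀ i < T, d (i + 1) * (Real.exp (-x i * (D i + 1) * (2 + k)) *
      Real.exp (x i * (2 + k) ^ 2 * (H i + 2))) + b i / (H i + 1).choose k ≤ d i)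
    {i : ℕ} (hi : i ≤ T) (W : Finset V) :
    ∃ I ⊆ W, G.IsIndepSet (I : Set V) ∧
      b i * #W - c i * degreeMoment G k W - d i * codegreeMoment G k W ≤ #I := by
  -- The hypothesis for `i + 1` holds for every vertex set, so it applies to whatever the round
  -- leaves behind.
  induction hi using Nat.decreasingInduction generalizing W with
  | self =>
    refine ⟨∅, empty_subset _, by simp, ?_⟩
    have := mul_nonneg (hc T) (Nat.cast_nonneg (α := ℝ) (degreeMoment G k W))
    have := mul_nonneg (hd T) (Nat.cast_nonneg (α := ℝ) (codegreeMoment G k W))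
    rw [hbT, card_empty]
    push_cast
    linarith
  | of_succ i hi ih =>
    obtain ⟨W₁, hW₁, hD, hH, hcard⟩ := exists_bounded_subset G W (hkD i hi) (hkH i hi)
    have hp0 : 0 ≤ 1 - Real.exp (-x i) := by
      have : Real.exp (-x i) ≤ 1 := Real.exp_le_one_iff.2 (by linarith [hx i hi])
      linarith
    have hp1 : 1 - Real.exp (-x i) < 1 := by linarith [Real.exp_pos (-x i)]
    obtain ⟨I₁, W₂, hI₁, hW₂, hind, hnadj, hval⟩ :=
      exists_nibble hp0 hp1 k hD hH (b := b (i + 1)) (hc (i + 1)) (hd (i + 1))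
    obtain ⟨I₂, hI₂, hind₂, hval₂⟩ := ih W₂
    refine ⟨I₁ ∪ I₂, union_subset (hI₁.trans hW₁) ((hI₂.trans hW₂).trans hW₁), ?_, ?_⟩
    · rw [coe_union, SimpleGraph.IsIndepSet, Set.pairwise_union]
      refine ⟨hind, hind₂, fun a ha w hw _ => ?_⟩
      have := (hnadj a (mem_coe.1 ha) w (hI₂ (mem_coe.1 hw))).2
      exact ⟨this, fun h => this h.symm⟩
    · have hdisj : Disjoint I₁ I₂ := disjoint_left.2 fun a ha ha' =>
        (hnadj a ha a (hI₂ ha')).1 rfl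
      rw [card_union_of_disjoint hdisj, Nat.cast_add]
      have hm1 : (degreeMoment G k W₁ : ℝ) ≤ degreeMoment G k W := by
        exact_mod_cast binomialMoment_mono hW₁
      have hm2 : (codegreeMoment G k W₁ : ℝ) ≤ codegreeMoment G k W := by
        exact_mod_cast binomialMoment_mono hW₁
      have hq : ∀ n : ℕ, (1 - (1 - Real.exp (-x i))) ^ n = Real.exp (-x i * n) := fun n => by
        rw [sub_sub_cancel, ← Real.exp_nat_mul, mul_comm]
      simp only [hq, ← Real.exp_sub] at hval
      push_cast at hval
      simp only [← Real.exp_add] at hci hdi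
      have r1 : -x i * (((D i : ℝ) + 1) * (1 + k)) - -x i * ((1 + k) ^ 2 * (H i + 2))
        = -x i * (D i + 1) * (1 + k) + x i * (1 + k) ^ 2 * (H i + 2) := by ring
      have r2 : -x i * (((D i : ℝ) + 1) * (2 + k)) - -x i * ((2 + k) ^ 2 * (H i + 2))
        = -x i * (D i + 1) * (2 + k) + x i * (2 + k) ^ 2 * (H i + 2) := by ring
      rw [r1, r2] at hval
      set R₁ := Real.exp (-x i * (D i + 1) * (1 + k) + x i * (1 + k) ^ 2 * (H i + 2))
      set R₂ := Real.exp (-x i * (D i + 1) * (2 + k) + x i * (2 + k) ^ 2 * (H i + 2))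
      have s1 : b i * #W₁ ≤ Real.exp (-x i * (D i + 1)) * (1 - Real.exp (-x i) + b (i + 1)) * #W₁ :=
        mul_le_mul_of_nonneg_right (hbi i hi) (Nat.cast_nonneg _)
      have s2 := mul_le_mul_of_nonneg_left hcard (hb i)
      have s3 : c (i + 1) * (R₁ * degreeMoment G k W₁) ≤ c (i + 1) * (R₁ * degreeMoment G k W) :=
        mul_le_mul_of_nonneg_left (mul_le_mul_of_nonneg_left hm1 (Real.exp_pos _).le) (hc _)
      have s4 : d (i + 1) * (R₂ * codegreeMoment G k W₁)
          ≤ d (i + 1) * (R₂ * codegreeMoment G k W) :=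
        mul_le_mul_of_nonneg_left (mul_le_mul_of_nonneg_left hm2 (Real.exp_pos _).le) (hd _)
      have s5 := mul_le_mul_of_nonneg_right (hci i hi)
        (Nat.cast_nonneg (α := ℝ) (degreeMoment G k W))
      have s6 := mul_le_mul_of_nonneg_right (hdi i hi)
        (Nat.cast_nonneg (α := ℝ) (codegreeMoment G k W))
      have s2' : b i * ((#W : ℝ) - degreeMoment G k W / (D i + 1).choose k
          - codegreeMoment G k W / (H i + 1).choose k)
        = b i * #W - b i / (D i + 1).choose k * degreeMoment G k W
          - b i / (H i + 1).choose k * codegreeMoment G k W := by ring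
      rw [s2'] at s2
      rw [add_mul] at s5 s6
      linarith

end NibbleGraph

/-! ### Choice of weights and the bound after `T` rounds. -/

section NibbleAnalysis

open Finset

/-- The `k` added to the threshold absorbs the falling factorial. -/
lemma pow_div_factorial_le_choose {a : ℝ} (ha : 0 ≤ a) (k : ℕ) :
    a ^ k / k.factorial ≤ ((⌊a⌋₊ + k + 1).choose k : ℝ) := by
  have h := Nat.pow_le_choose (α := ℝ) k (⌊a⌋₊ + k + 1)
  refine le_trans (div_le_div_of_nonneg_right (pow_le_pow_left₀ ha ?_ k) (by positivity)) h
  have h1 : ⌊a⌋₊ + k + 1 + 1 - k = ⌊a⌋₊ + 1 + 1 := by omega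
  rw [h1]
  push_cast
  linarith [Nat.lt_floor_add_one a]

lemma choose_le_pow_div_factorial {a : ℝ} {m : ℕ} (hm : (m : ℝ) ≤ a) (k : ℕ) :
    (m.choose k : ℝ) ≤ a ^ k / k.factorial :=
  (Nat.choose_le_pow_div k m).trans (by gcongr)

/-- The recursion for the weights `c` and `d`: `T - i` counts the discards still to be paid for, `y`
is the present one, and `exp ((T - i) / T)` absorbs a dependence error `θ ≤ 1 / T` in every round.
-/
lemma weight_step {T i : ℕ} (hi : i < T) {B ε s θ y : ℝ} (hB : 0 ≤ B)
    (hθ : θ ≤ 1 / T) (hy : y ≤ B * Real.exp (ε * i * s)) :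
    ((T - (i + 1) : ℕ) : ℝ) * B * Real.exp (ε * (i + 1 : ℕ) * s)
        * Real.exp ((T - (i + 1) : ℕ) / T) * (Real.exp (-ε * s) * Real.exp θ) + y
      ≤ ((T - i : ℕ) : ℝ) * B * Real.exp (ε * i * s) * Real.exp ((T - i : ℕ) / T) := by
  obtain ⟨j, rfl⟩ : ∃ j, T = i + 1 + j := ⟨T - (i + 1), by omega⟩
  have h1 : i + 1 + j - (i + 1) = j := by omega
  have h2 : i + 1 + j - i = j + 1 := by omega
  rw [h1, h2]
  set T : ℕ := i + 1 + j
  have e1 : Real.exp (ε * (i + 1 : ℕ) * s) * Real.exp (-ε * s) = Real.exp (ε * i * s) := by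
    rw [← Real.exp_add]
    push_cast
    ring_nf
  have e2 : Real.exp ((j : ℝ) / T) * Real.exp θ ≤ Real.exp ((j + 1 : ℕ) / T) := by
    rw [← Real.exp_add, Real.exp_le_exp]
    push_cast
    rw [add_div]
    linarith
  have e3 : 1 ≤ Real.exp ((j + 1 : ℕ) / T) := Real.one_le_exp (by positivity)
  have hP : 0 ≤ B * Real.exp (ε * i * s) := mul_nonneg hB (Real.exp_pos _).le
  calc (j : ℝ) * B * Real.exp (ε * (i + 1 : ℕ) * s) * Real.exp (j / T)
          * (Real.exp (-ε * s) * Real.exp θ) + y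
      = j * B * (Real.exp (ε * (i + 1 : ℕ) * s) * Real.exp (-ε * s))
          * (Real.exp (j / T) * Real.exp θ) + y := by ring
    _ = j * (B * Real.exp (ε * i * s)) * (Real.exp (j / T) * Real.exp θ) + y := by rw [e1]; ring
    _ ≤ j * (B * Real.exp (ε * i * s)) * Real.exp ((j + 1 : ℕ) / T)
          + B * Real.exp (ε * i * s) * Real.exp ((j + 1 : ℕ) / T) := by
        refine add_le_add (mul_le_mul_of_nonneg_left e2 (by positivity)) (hy.trans ?_)
        exact le_mul_of_one_le_right hP e3
    _ = _ := by push_cast; ring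

variable {V : Type*} [Fintype V] [DecidableEq V] (G : SimpleGraph V) [DecidableRel G.Adj]

lemma degreeMoment_univ_le {Δ : ℝ} (hΔ : ∀ v, (G.degree v : ℝ) ≤ Δ) (k : ℕ) :
    (degreeMoment G k univ : ℝ) ≤ Fintype.card V * (Δ ^ k / k.factorial) := by
  rw [degreeMoment, binomialMoment_univ, Nat.cast_sum, ← nsmul_eq_mul]
  exact sum_le_card_nsmul _ _ _ fun v _ => choose_le_pow_div_factorial (hΔ v) k

/-- Double counting of paths of length two by their middle vertex. -/
lemma sum_card_inter_neighborFinset_le {Δ : ℝ} (hΔ : ∀ v, (G.degree v : ℝ) ≤ Δ) :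
    ∑ q ∈ (univ : Finset V).offDiag, (#(G.neighborFinset q.1 ∩ G.neighborFinset q.2) : ℝ)
      ≤ Fintype.card V * Δ ^ 2 := by
  have h1 : ∀ u v : V, (#(G.neighborFinset u ∩ G.neighborFinset v) : ℝ)
      = ∑ w, (if G.Adj w u then 1 else 0) * (if G.Adj w v then 1 else 0) := by
    intro u v
    have : G.neighborFinset u ∩ G.neighborFinset v = univ.filter fun w => G.Adj w u ∧ G.Adj w v := by
      ext w; simp [G.adj_comm]
    rw [this, card_filter, Nat.cast_sum]
    refine sum_congr rfl fun w _ => ?_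
    by_cases h : G.Adj w u <;> by_cases h' : G.Adj w v <;> simp [h, h']
  have h2 : ∀ w, ∑ u, (if G.Adj w u then (1 : ℝ) else 0) = G.degree w := by
    intro w
    rw [sum_boole, ← G.card_neighborFinset_eq_degree, G.neighborFinset_eq_filter]
  calc _ ≤ ∑ q : V × V, (#(G.neighborFinset q.1 ∩ G.neighborFinset q.2) : ℝ) :=
        sum_le_sum_of_subset_of_nonneg (subset_univ _) fun _ _ _ => Nat.cast_nonneg _
    _ = ∑ w, (G.degree w : ℝ) ^ 2 := by
        simp_rw [h1]
        rw [sum_comm]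
        refine sum_congr rfl fun w _ => ?_
        rw [Fintype.sum_prod_type, sq, ← h2, sum_mul_sum]
    _ ≤ Fintype.card V * Δ ^ 2 := by
        rw [← nsmul_eq_mul]
        exact sum_le_card_nsmul _ _ _ fun v _ => pow_le_pow_left₀ (Nat.cast_nonneg _) (hΔ v) 2

/-- Only pairs with a common neighbour contribute, and each has codegree at least one, so their
number is at most the codegree sum. This keeps the bound linear in the number of vertices. -/
lemma codegreeMoment_univ_le {Δ η : ℝ} (hη : 0 ≤ η)
    (hΔ : ∀ v, (G.degree v : ℝ) ≤ Δ)
    (hcod : ∀ u v, u ≠ v → (#(G.neighborFinset u ∩ G.neighborFinset v) : ℝ) ≤ η)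
    {k : ℕ} (hk : k ≠ 0) :
    (codegreeMoment G k univ : ℝ) ≤ Fintype.card V * Δ ^ 2 * (η ^ k / k.factorial) := by
  rw [codegreeMoment, binomialMoment_univ, Nat.cast_sum]
  refine le_trans (sum_le_sum fun q hq => ?_)
    ((sum_mul _ _ _).symm.le.trans
      (mul_le_mul_of_nonneg_right (sum_card_inter_neighborFinset_le G hΔ) (by positivity)))
  have h := hcod q.1 q.2 (mem_offDiag.1 hq).2.2
  rcases Nat.eq_zero_or_pos #(G.neighborFinset q.1 ∩ G.neighborFinset q.2) with h0 | h0
  · rw [h0, Nat.choose_eq_zero_of_lt (Nat.pos_of_ne_zero hk)]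
    simp
  · refine (choose_le_pow_div_factorial h k).trans (le_mul_of_one_le_left (by positivity) ?_)
    exact_mod_cast h0

/-- The bound on the independence number from `T` steps of the nibble with parameters `ε`, `k`. -/
theorem le_indepNum_of_nibble {Δ η ε μ : ℝ} {k T : ℕ} (hΔ0 : 0 < Δ) (hη : 0 < η) (hε : 0 < ε)
    (hk : k ≠ 0) (hT : 0 < T)
    (hΔ : ∀ v, (G.degree v : ℝ) ≤ Δ)
    (hcod : ∀ u v, u ≠ v → (#(G.neighborFinset u ∩ G.neighborFinset v) : ℝ) ≤ η)
    (hμ0 : 0 < μ) (hμ : μ ≤ Real.exp (-ε * T) * Δ) (hkμ : k + 1 ≤ ε * μ)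
    (hcorr : T * ε * (k + 2) ^ 2 * (Real.exp 3 * η / Δ + (k + 2) / μ) ≤ 1) :
    T * (ε * Real.exp (-2 * ε) / ((1 + 2 * ε) * Δ)) * Fintype.card V
      * (1 - T * Real.exp 1 / (1 + ε) ^ k - T * Real.exp 1 * Δ ^ 2 / Real.exp 3 ^ k)
      ≤ G.indepNum := by
  -- `g` is the guaranteed gain per original vertex and round. The thresholds `D`, `H` follow the
  -- expected decay with slack factors `1 + ε` and `exp 3`, and `x` makes the survival probability
  -- exactly `exp (-ε)`.
  set g : ℝ := ε * Real.exp (-2 * ε) / ((1 + 2 * ε) * Δ) with hg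
  have hg0 : 0 < g := by positivity
  have hT0 : (0 : ℝ) < T := by exact_mod_cast hT
  set D : ℕ → ℕ := fun i => ⌊(1 + ε) * Δ / Real.exp (ε * i)⌋₊ + k with hD
  set H : ℕ → ℕ := fun i => ⌊Real.exp 3 * η / Real.exp (ε * i)⌋₊ + k with hH
  set x : ℕ → ℝ := fun i => ε / (D i + 1) with hx
  set B₁ : ℝ := T * g * k.factorial / ((1 + ε) * Δ) ^ k with hB₁
  set B₂ : ℝ := T * g * k.factorial / (Real.exp 3 * η) ^ k with hB₂
  have hB₁0 : 0 ≤ B₁ := by positivity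
  have hB₂0 : 0 ≤ B₂ := by positivity
  -- `b i` values a vertex by the gain of the remaining `T - i` rounds; `exp (ε * i)` offsets the
  -- shrinking of the vertex set.
  set b : ℕ → ℝ := fun i => ((T - i : ℕ) : ℝ) * g * Real.exp (ε * i) with hb
  set c : ℕ → ℝ := fun i =>
    ((T - i : ℕ) : ℝ) * B₁ * Real.exp (ε * i * (1 + k)) * Real.exp ((T - i : ℕ) / T) with hc
  set d : ℕ → ℝ := fun i =>
    ((T - i : ℕ) : ℝ) * B₂ * Real.exp (ε * i * (2 + k)) * Real.exp ((T - i : ℕ) / T) with hd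
  have hxD : ∀ i, -x i * (D i + 1) = -ε := fun i => by
    simp only [hx]
    field_simp
  have hx0 : ∀ i, 0 ≤ x i := fun i => by simp only [hx]; positivity
  have hμi : ∀ i < T, μ ≤ Δ / Real.exp (ε * i) := fun i hi => by
    refine hμ.trans ?_
    rw [div_eq_mul_inv, ← Real.exp_neg, mul_comm]
    refine mul_le_mul_of_nonneg_left (Real.exp_le_exp.2 ?_) hΔ0.le
    have : (i : ℝ) ≤ T := by exact_mod_cast hi.le
    nlinarith
  have hDlow : ∀ i : ℕ, Δ / Real.exp (ε * i) ≤ D i + 1 := fun i => by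
    have h1 := Nat.lt_floor_add_one ((1 + ε) * Δ / Real.exp (ε * i))
    have h2 : Δ / Real.exp (ε * i) ≤ (1 + ε) * Δ / Real.exp (ε * i) := by
      gcongr
      nlinarith
    simp only [hD]
    push_cast
    have : (0 : ℝ) ≤ k := Nat.cast_nonneg k
    linarith
  -- The additive `k + 1` costs only another `ε`, since degrees stay at the scale `μ` or above.
  have hDup : ∀ i < T, (D i : ℝ) + 1 ≤ (1 + 2 * ε) * (Δ / Real.exp (ε * i)) := fun i hi => by
    have h1 := Nat.floor_le (a := (1 + ε) * Δ / Real.exp (ε * i)) (by positivity)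
    have h2 := mul_le_mul_of_nonneg_left (hμi i hi) hε.le
    simp only [hD]
    push_cast
    rw [mul_div_assoc] at h1
    rw [mul_div_assoc]
    linarith
  have hθ : ∀ i < T, ∀ s : ℝ, 0 ≤ s → s ≤ k + 2 → x i * s ^ 2 * (H i + 2) ≤ 1 / T := by
    intro i hi s hs0 hs
    have hHi : (H i : ℝ) + 2 ≤ Real.exp 3 * η / Real.exp (ε * i) + (k + 2) := by
      have h1 := Nat.floor_le (a := Real.exp 3 * η / Real.exp (ε * i)) (by positivity)
      simp only [hH]
      push_cast
      linarith
    have hEi := Real.exp_pos (ε * i)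
    have hdiv : ((H i : ℝ) + 2) / (D i + 1) ≤ Real.exp 3 * η / Δ + (k + 2) / μ := by
      calc ((H i : ℝ) + 2) / (D i + 1)
          ≤ (Real.exp 3 * η / Real.exp (ε * i) + (k + 2)) / (Δ / Real.exp (ε * i)) :=
            div_le_div₀ (by positivity) hHi (by positivity) (hDlow i)
        _ = Real.exp 3 * η / Δ + (k + 2) / (Δ / Real.exp (ε * i)) := by
            rw [add_div, div_div_div_cancel_right₀ hEi.ne']
        _ ≤ _ := by
            have := hμi i hi
            gcongr
    have hs2 : s ^ 2 ≤ ((k : ℝ) + 2) ^ 2 := by gcongr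
    rw [le_div_iff₀ hT0]
    calc x i * s ^ 2 * (H i + 2) * T
        = T * ε * s ^ 2 * (((H i : ℝ) + 2) / (D i + 1)) := by simp only [hx]; ring
      _ ≤ T * ε * (k + 2) ^ 2 * (Real.exp 3 * η / Δ + (k + 2) / μ) := by gcongr
      _ ≤ 1 := hcorr
  have hbT : ∀ i : ℕ, b i ≤ T * g * Real.exp (ε * i) := fun i => by
    have : ((T - i : ℕ) : ℝ) ≤ T := by exact_mod_cast Nat.sub_le T i
    simp only [hb]
    gcongr
  have hbC : ∀ i : ℕ, ∀ a : ℝ, 0 < a →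
      b i / ((⌊a / Real.exp (ε * i)⌋₊ + k + 1).choose k : ℝ)
        ≤ T * g * k.factorial / a ^ k * Real.exp (ε * i * (1 + k)) := by
    intro i a ha
    have hEi := Real.exp_pos (ε * i)
    have h1 := pow_div_factorial_le_choose (div_pos ha hEi).le k
    calc b i / ((⌊a / Real.exp (ε * i)⌋₊ + k + 1).choose k : ℝ)
        ≤ (T * g * Real.exp (ε * i)) / ((a / Real.exp (ε * i)) ^ k / k.factorial) :=
          div_le_div₀ (by positivity) (hbT i) (by positivity) h1
      _ = _ := by
          have : Real.exp (ε * i * (1 + k)) = Real.exp (ε * i) * Real.exp (ε * i) ^ k := by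
            rw [← Real.exp_nat_mul, ← Real.exp_add]
            ring_nf
          rw [this, div_pow]
          field_simp
  obtain ⟨I, -, hI, hle⟩ := exists_isIndepSet_of_weights G k T D H x b c d
    (fun i _ => hx0 i) (fun i _ => by simp only [hD]; omega) (fun i _ => by simp only [hH]; omega)
    (fun i => by simp only [hb]; positivity) (fun i => by simp only [hc]; positivity)
    (fun i => by simp only [hd]; positivity) (by simp [hb])
    (by
      intro i hi
      rw [hxD]
      have hxlow : ε * Real.exp (ε * i) / ((1 + 2 * ε) * Δ) ≤ x i := by
        have := hDup i hi
        have hEi := Real.exp_pos (ε * i)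
        have e : ε * Real.exp (ε * i) / ((1 + 2 * ε) * Δ)
            = ε / ((1 + 2 * ε) * (Δ / Real.exp (ε * i))) := by field_simp
        rw [e]
        simp only [hx]
        gcongr
      have hxε : x i ≤ ε := by
        simp only [hx]
        exact div_le_self hε.le (by linarith [Nat.cast_nonneg (α := ℝ) (D i)])
      have h1 : x i * Real.exp (-ε) ≤ 1 - Real.exp (-x i) := by
        have h2 : Real.exp (-ε) ≤ Real.exp (-x i) := Real.exp_le_exp.2 (by linarith)
        have h3 := mul_le_mul_of_nonneg_left h2 (hx0 i)
        have h4 := mul_le_mul_of_nonneg_right (Real.add_one_le_exp (x i)) (Real.exp_pos (-x i)).le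
        rw [← Real.exp_add, add_neg_cancel, Real.exp_zero] at h4
        linarith
      have h2 : Real.exp (-ε) * b (i + 1) = ((T - (i + 1) : ℕ) : ℝ) * g * Real.exp (ε * i) := by
        simp only [hb]
        rw [mul_left_comm, ← Real.exp_add]
        push_cast
        ring_nf
      have h3 : g * Real.exp (ε * i) ≤ Real.exp (-ε) * (1 - Real.exp (-x i)) := by
        calc g * Real.exp (ε * i)
            = Real.exp (-ε) * (ε * Real.exp (ε * i) / ((1 + 2 * ε) * Δ) * Real.exp (-ε)) := by
              have : Real.exp (-2 * ε) = Real.exp (-ε) * Real.exp (-ε) := by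
                rw [← Real.exp_add]; ring_nf
              rw [hg, this]
              ring
          _ ≤ _ := mul_le_mul_of_nonneg_left
              ((mul_le_mul_of_nonneg_right hxlow (Real.exp_pos _).le).trans h1) (Real.exp_pos _).le
      have h4 : b i = ((T - (i + 1) : ℕ) : ℝ) * g * Real.exp (ε * i) + g * Real.exp (ε * i) := by
        have : T - i = T - (i + 1) + 1 := by omega
        simp only [hb]
        rw [this]
        push_cast
        ring
      rw [h4, mul_add, h2]
      linarith)
    (by
      intro i hi
      rw [hxD]
      exact weight_step hi hB₁0 (hθ i hi _ (by positivity) (by linarith))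
        (hbC i _ (by positivity)))
    (by
      intro i hi
      rw [hxD]
      refine weight_step hi hB₂0 (hθ i hi _ (by positivity) (by linarith))
        ((hbC i _ (by positivity)).trans ?_)
      -- The discard cost grows with exponent `1 + k`, which is below the `2 + k` built into `d`.
      refine mul_le_mul_of_nonneg_left (Real.exp_le_exp.2 ?_) hB₂0
      gcongr
      norm_num)
    (Nat.zero_le T) univ
  have hfin : (#I : ℝ) ≤ G.indepNum := by exact_mod_cast hI.card_le_indepNum
  refine le_trans ?_ (hle.trans hfin)
  have y1 := degreeMoment_univ_le G hΔ k
  have y2 := codegreeMoment_univ_le G hη.le hΔ hcod hk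
  have c0 : c 0 = T * B₁ * Real.exp 1 := by simp [hc, hT0.ne']
  have d0 : d 0 = T * B₂ * Real.exp 1 := by simp [hd, hT0.ne']
  have b0 : b 0 = T * g := by simp [hb]
  rw [c0, d0, b0, card_univ]
  have z1 := mul_le_mul_of_nonneg_left y1 (show 0 ≤ T * B₁ * Real.exp 1 by positivity)
  have z2 := mul_le_mul_of_nonneg_left y2 (show 0 ≤ T * B₂ * Real.exp 1 by positivity)
  have w1 : T * B₁ * Real.exp 1 * (Fintype.card V * (Δ ^ k / k.factorial))
      = T * g * Fintype.card V * (T * Real.exp 1 / (1 + ε) ^ k) := by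
    rw [hB₁, mul_pow]
    field_simp
  have w2 : T * B₂ * Real.exp 1 * (Fintype.card V * Δ ^ 2 * (η ^ k / k.factorial))
      = T * g * Fintype.card V * (T * Real.exp 1 * Δ ^ 2 / Real.exp 3 ^ k) := by
    rw [hB₂, mul_pow]
    field_simp
  rw [w1] at z1
  rw [w2] at z2
  linarith

end NibbleAnalysis

/-! ### Parameters for large `Δ`. -/

section NibbleAsymptotics

open Finset Filter Topology

lemma eventually_mul_pow_le_exp (C : ℝ) {a : ℝ} (ha : 0 < a) (m : ℕ) :
    ∀ᶠ L : ℝ in atTop, C * L ^ m ≤ Real.exp (a * L) := by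
  have h := (isLittleO_pow_exp_pos_mul_atTop m ha).def (c := 1 / (|C| + 1)) (by positivity)
  filter_upwards [h, eventually_ge_atTop 0] with L hL hL0
  rw [Real.norm_of_nonneg (by positivity), Real.norm_of_nonneg (Real.exp_pos _).le, one_div,
    inv_mul_eq_div, le_div_iff₀ (by positivity)] at hL
  nlinarith [le_abs_self C, pow_nonneg hL0 m]

set_option maxHeartbeats 2000000 in
/-- For large maximum degree the nibble gives all but a proportion `7 * ε` of the bound. -/
theorem eventually_le_indepNum {ε : ℝ} (hε : 0 < ε) (hε' : ε ≤ 1 / 4) :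
    ∀ᶠ Δ : ℝ in atTop, ∀ (V : Type*) [Fintype V] [DecidableEq V] (G : SimpleGraph V)
      [DecidableRel G.Adj], (G.maxDegree : ℝ) ≤ Δ →
      (G.maxCodegree : ℝ) ≤ (1 / 2 ^ 7) * Δ * (1 / Real.log Δ ^ 7) →
      (1 - 7 * ε) * ((Fintype.card V : ℝ) * Real.log Δ / Δ) ≤ (G.indepNum : ℝ) := by
  have hlog : 0 < Real.log (1 + ε) := Real.log_pos (by linarith)
  have hev : ∀ᶠ L : ℝ in atTop, 3 ≤ L ∧ 3 / ε * L ^ 1 ≤ Real.exp (ε * L) ∧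
      16 * L ^ 4 ≤ Real.exp (ε * L) ∧
      2 * Real.exp 1 / ε ^ 2 * L ^ 1 ≤ Real.exp (Real.log (1 + ε) * L) ∧
      2 * Real.exp 1 / ε ^ 2 * L ^ 1 ≤ Real.exp (1 * L) :=
    (eventually_ge_atTop 3).and ((eventually_mul_pow_le_exp _ hε 1).and
      ((eventually_mul_pow_le_exp _ hε 4).and ((eventually_mul_pow_le_exp _ hlog 1).and
        (eventually_mul_pow_le_exp _ one_pos 1))))
  filter_upwards [Real.tendsto_log_atTop.eventually hev, eventually_gt_atTop 0] with Δ hL hΔ0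
  intro V _ _ G _ hdeg hcod
  set L := Real.log Δ with hLdef
  obtain ⟨hL3, hA, hB, hC, hE⟩ := hL
  rw [pow_one] at hA hC hE
  rw [one_mul] at hE
  have hexpL : Real.exp L = Δ := Real.exp_log hΔ0
  have hL0 : 0 < L := by linarith
  -- With `k ≥ log Δ`, `(1 + ε) ^ k` is at least a positive power of `Δ`, and `exp 3 ^ k ≥ Δ ^ 3`
  -- beats the factor `Δ ^ 2` from the codegree pairs. The choice of `T` stops while the degree
  -- scale is still at least `Δ ^ ε = exp (ε * L)`.
  set k := ⌈L⌉₊ with hk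
  set T := ⌊(1 - ε) * L / ε⌋₊ with hT
  have hkL : L ≤ k := Nat.le_ceil L
  have hkL' : (k : ℝ) < L + 1 := Nat.ceil_lt_add_one hL0.le
  have hTle : (T : ℝ) ≤ (1 - ε) * L / ε := Nat.floor_le (div_nonneg (by nlinarith) hε.le)
  have hTlt : (1 - ε) * L / ε < T + 1 := Nat.lt_floor_add_one _
  have hTε : T * ε ≤ (1 - ε) * L := (le_div_iff₀ hε).1 hTle
  have hTε' : (1 - 2 * ε) * L ≤ T * ε := by
    have := (div_lt_iff₀ hε).1 hTlt
    nlinarith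
  have hT0 : 0 < T := by
    have : (0 : ℝ) < T * ε := lt_of_lt_of_le (by nlinarith) hTε'
    exact_mod_cast pos_of_mul_pos_left this hε.le
  have hk0 : k ≠ 0 := (Nat.ceil_pos.2 hL0).ne'
  have hTL : T * ε ≤ L := by nlinarith
  have hTdiv : (T : ℝ) ≤ L / ε := (le_div_iff₀ hε).2 hTL
  set η := (1 / 2 ^ 7) * Δ * (1 / L ^ 7) with hη
  have hη0 : 0 < η := by positivity
  have main := le_indepNum_of_nibble G (Δ := Δ) (η := η) (ε := ε) (μ := Real.exp (ε * L))
    (k := k) (T := T) hΔ0 hη0 hε hk0 hT0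
    (fun v => le_trans (by exact_mod_cast G.degree_le_maxDegree v) hdeg)
    (fun u v huv => le_trans (by
      have := Finset.le_sup (f := fun p : V × V =>
        #(G.neighborFinset p.1 ∩ G.neighborFinset p.2))
        (show (u, v) ∈ (univ : Finset V).offDiag by simp [huv])
      exact_mod_cast this) hcod)
    (Real.exp_pos _)
    (by
      rw [← hexpL, ← Real.exp_add, Real.exp_le_exp]
      linarith)
    (by
      rw [div_mul_eq_mul_div, div_le_iff₀ hε] at hA
      linarith)
    (by
      have h3 : Real.exp 3 ≤ 27 := by
        have h1 : Real.exp 1 ≤ 3 := by linarith [Real.exp_one_lt_d9]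
        have h2 : Real.exp 3 = Real.exp 1 ^ 3 := by rw [← Real.exp_nat_mul]; norm_num
        rw [h2]
        calc Real.exp 1 ^ 3 ≤ 3 ^ 3 := pow_le_pow_left₀ (Real.exp_pos _).le h1 3
          _ = 27 := by norm_num
      have hk2 : (k : ℝ) + 2 ≤ 2 * L := by linarith
      -- The prefactor is at most `4 * L ^ 3`, so each summand may be `1 / (8 * L ^ 3)`; the
      -- codegree hypothesis has room to spare here.
      have f1 : Real.exp 3 * η / Δ ≤ 1 / (8 * L ^ 3) := by
        have : Real.exp 3 * η / Δ = Real.exp 3 / (128 * L ^ 7) := by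
          rw [hη]
          field_simp
          norm_num
        rw [this, div_le_div_iff₀ (by positivity) (by positivity)]
        have hL4 : (81 : ℝ) ≤ L ^ 4 := by
          calc (81 : ℝ) = 3 ^ 4 := by norm_num
            _ ≤ L ^ 4 := by gcongr
        have : L ^ 7 = L ^ 4 * L ^ 3 := by ring
        rw [this]
        nlinarith [pow_pos hL0 3]
      have f2 : ((k : ℝ) + 2) / Real.exp (ε * L) ≤ 1 / (8 * L ^ 3) := by
        rw [div_le_div_iff₀ (Real.exp_pos _) (by positivity)]
        calc ((k : ℝ) + 2) * (8 * L ^ 3) ≤ (2 * L) * (8 * L ^ 3) := by gcongr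
          _ = 16 * L ^ 4 := by ring
          _ ≤ _ := by linarith
      calc T * ε * ((k : ℝ) + 2) ^ 2 * (Real.exp 3 * η / Δ + (k + 2) / Real.exp (ε * L))
          ≤ L * (2 * L) ^ 2 * (1 / (8 * L ^ 3) + 1 / (8 * L ^ 3)) := by gcongr
        _ = 1 := by field_simp; norm_num)
  refine le_trans ?_ main
  have e1 : T * Real.exp 1 / (1 + ε) ^ k ≤ ε / 2 := by
    have h1 : Real.exp (Real.log (1 + ε) * L) ≤ (1 + ε) ^ k := by
      rw [← Real.rpow_def_of_pos (by linarith), ← Real.rpow_natCast]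
      exact Real.rpow_le_rpow_of_exponent_le (by linarith) hkL
    rw [div_le_iff₀ (by positivity)]
    calc T * Real.exp 1 ≤ L / ε * Real.exp 1 := by gcongr
      _ = ε / 2 * (2 * Real.exp 1 / ε ^ 2 * L) := by field_simp
      _ ≤ ε / 2 * (1 + ε) ^ k := by gcongr; exact hC.trans h1
  have e2 : T * Real.exp 1 * Δ ^ 2 / Real.exp 3 ^ k ≤ ε / 2 := by
    have h1 : Real.exp L * Δ ^ 2 ≤ Real.exp 3 ^ k := by
      rw [← hexpL, ← Real.exp_nat_mul, ← Real.exp_nat_mul, ← Real.exp_add, Real.exp_le_exp]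
      push_cast
      linarith
    rw [div_le_iff₀ (by positivity)]
    calc T * Real.exp 1 * Δ ^ 2 ≤ L / ε * Real.exp 1 * Δ ^ 2 := by gcongr
      _ = ε / 2 * ((2 * Real.exp 1 / ε ^ 2 * L) * Δ ^ 2) := by field_simp
      _ ≤ ε / 2 * (Real.exp L * Δ ^ 2) := by gcongr
      _ ≤ ε / 2 * Real.exp 3 ^ k := by gcongr
  have hexp : 1 - 2 * ε ≤ Real.exp (-2 * ε) := by linarith [Real.add_one_le_exp (-2 * ε)]
  have hinv : 1 - 2 * ε ≤ 1 / (1 + 2 * ε) := by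
    rw [le_div_iff₀ (by linarith)]
    nlinarith
  have hc : 0 ≤ 1 - 2 * ε := by linarith
  have hn : (0 : ℝ) ≤ Fintype.card V := Nat.cast_nonneg _
  calc (1 - 7 * ε) * (Fintype.card V * L / Δ)
      -- The losses come from rounding and stopping early in `T`, from `exp (-2 * ε)`, from `1 / (1
      -- + 2 * ε)`, and from the two moment terms; to first order they total `7 * ε`.
      ≤ ((1 - 2 * ε) * (1 - 2 * ε) * (1 - 2 * ε) * (1 - ε)) * (Fintype.card V * L / Δ) := by
        refine mul_le_mul_of_nonneg_right ?_ (by positivity)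
        nlinarith [mul_pos hε hε, mul_pos (mul_pos hε hε) hε, mul_nonneg (mul_pos hε hε).le hc]
    _ = ((1 - 2 * ε) * L) * (1 - 2 * ε) * (1 - 2 * ε) * Fintype.card V * (1 - ε) / Δ := by ring
    _ ≤ (T * ε) * Real.exp (-2 * ε) * (1 / (1 + 2 * ε)) * Fintype.card V * (1 - ε) / Δ := by
        have : 0 ≤ 1 - ε := by linarith
        gcongr
    _ = T * (ε * Real.exp (-2 * ε) / ((1 + 2 * ε) * Δ)) * Fintype.card V * (1 - ε) := by
        field_simp
    _ ≤ _ := by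
        refine mul_le_mul_of_nonneg_left (by linarith) (by positivity)

end NibbleAsymptotics

theorem theorem3 :
    ∃ f : ℝ → ℝ, Filter.Tendsto f Filter.atTop (nhds 0) ∧
      ∀ (Δ : ℝ), 1 < Δ →
        ∀ (V : Type*) [Fintype V] [DecidableEq V] (G : SimpleGraph V) [DecidableRel G.Adj],
          (G.maxDegree : ℝ) ≤ Δ →
          (G.maxCodegree : ℝ) ≤ (1 / 2 ^ 7) * Δ * (1 / Real.log Δ ^ 7) →
          (1 - f Δ) * ((Fintype.card V : ℝ) * Real.log Δ / Δ) ≤ (G.indepNum : ℝ) := by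
  -- Taking `f Δ` as the infimum of the admissible losses merges the bounds for all `ε` into one
  -- function. The infimum is itself admissible, because each graph imposes a closed condition on
  -- `t`.
  set S : ℝ → Set ℝ := fun Δ => {t | 0 ≤ t ∧
    ∀ (V : Type _) [Fintype V] [DecidableEq V] (G : SimpleGraph V) [DecidableRel G.Adj],
      (G.maxDegree : ℝ) ≤ Δ →
      (G.maxCodegree : ℝ) ≤ (1 / 2 ^ 7) * Δ * (1 / Real.log Δ ^ 7) →
      (1 - t) * ((Fintype.card V : ℝ) * Real.log Δ / Δ) ≤ (G.indepNum : ℝ)} with hS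
  have hbdd : ∀ Δ, BddBelow (S Δ) := fun Δ => ⟨0, fun t ht => ht.1⟩
  refine ⟨fun Δ => sInf (S Δ), ?_, ?_⟩
  · rw [Metric.tendsto_nhds]
    intro r hr
    have hε : 0 < min (1 / 4) (r / 8) := by positivity
    filter_upwards [eventually_le_indepNum hε (min_le_left _ _)] with Δ hΔ
    have h1 : sInf (S Δ) ≤ 7 * min (1 / 4) (r / 8) :=
      csInf_le (hbdd Δ) ⟨by positivity, hΔ⟩
    have h2 : 0 ≤ sInf (S Δ) := Real.sInf_nonneg fun t ht => ht.1
    rw [Real.dist_0_eq_abs, abs_of_nonneg h2]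
    linarith [min_le_right (1 / 4) (r / 8)]
  · intro Δ hΔ V _ _ G _ hdeg hcod
    have hne : (S Δ).Nonempty := ⟨1, zero_le_one, fun V _ _ G _ _ _ => by simp⟩
    set X : ℝ := (Fintype.card V : ℝ) * Real.log Δ / Δ with hX
    have hX0 : 0 ≤ X :=
      div_nonneg (mul_nonneg (Nat.cast_nonneg _) (Real.log_pos hΔ).le) (by linarith)
    rcases hX0.eq_or_lt with h | h
    · rw [← h, mul_zero]
      exact Nat.cast_nonneg _
    · have : 1 - (G.indepNum : ℝ) / X ≤ sInf (S Δ) := by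
        refine le_csInf hne fun t ht => ?_
        have := (le_div_iff₀ h).2 (ht.2 V G hdeg hcod)
        linarith
      rw [← le_div_iff₀ h]
      linarith
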